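/- Let $m\ge 2$. **Spherical tower.** Put $\hat P^0(m)=\mathbb R^{m+1}$ and $\hat\Delta_0=T\mathbb R^{m+1}$. Inductively, given the manifold $\hat P^{j}(m)$ with its distribution $\hat\Delta_j$, choose any smooth Riemannian metric $g_j$ on the bundle $\hat\Delta_j$, let $$\hat P^{j+1}(m)=\{(x,\nu): x\in\hat P^{j}(m),\ \nu\in\hat\Delta_j(x),\ g_j(\nu,\nu)=1\}\subset T\hat P^j(m)$$ be its unit sphere bundle, with projection $\hat\pi^{j+1}(x,\nu)=x$, and let $\hat\Delta_{j+1}$ be the spherical prolongation of $\hat\Delta_j$, $$\hat\Delta_{j+1}(x,\nu)=\{v\in T_{(x,\nu)}\hat P^{j+1}(m): d\hat\pi^{j+1}(v)=\lambda\nu\text{ for some }\lambda\in\mathbb R\}.$$ (One admissible choice is to start with the Euclidean metric of $\mathbb R^{m+1}$ and to take on each $\hat P^{j+1}(m)$ the metric induced by the canonical (Sasaki) metric of $T\hat P^{j}(m)$.) **Articulated arm.** Let $$\mathcal C^k(m)=\{(x_0,\dots,x_k)\in(\mathbb R^{m+1})^{k+1}: \|x_i-x_{i+1}\|=1,\ 0\le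 i\le k-1\}$$ be the configuration space of an arm with $k$ unit bars, let $\rho^k:\mathcal C^k(m)\to\mathcal C^{k-1}(m)$ forget $x_k$, and let $\mathcal D_k(q)=T_q\mathcal C^k(m)\cap\mathcal E_k(q)$, where $\mathcal E_k$ is spanned by the vector fields $\mathcal Z_i=\sum_{r=1}^{m+1}(x_{i+1}^r-x_i^r)\,\partial/\partial x_i^r$, $0\le i\le k-1$, and $\partial/\partial x_k^r$, $1\le r\le m+1$. **Theorem.** There are maps $F^k:\hat P^k(m)\to\mathcal C^k(m)$, $k\ge 0$, with $F^0=\mathrm{id}_{\mathbb R^{m+1}}$, such that for every $k\ge1$ the map $F^k$ is a diffeomorphism of $\hat P^k(m)$ onto $\mathcal C^k(m)$ with (i) $\rho^k\circ F^k=F^{k-1}\circ\hat\pi^k$; (ii) $F^k_*(\hat\Delta_k)=\mathcal D_k$. -/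

import Mathlib

open Set Topology
open scoped ContDiff

noncomputable section

namespace Arm

/-! Smooth manifolds appear here as subsets `S` of finite-dimensional real normed spaces `V`, with
the usual extrinsic notions: a map on `S` is smooth if near each point it extends to a smooth map on
an open subset of `V`; tangent vectors are velocities of smooth curves in `S`; the tangent bundle of
`S` is a subset of `V × V`. -/

section Extrinsic

variable {V W : Type*} [NormedAddCommGroup V] [NormedSpace ℝ V]
  [NormedAddCommGroup W] [NormedSpace ℝ W]

/-- `F` is smooth on the subset `S`: locally it is the restriction of a smooth map defined on an
open set of the ambient space. -/
def SmoothOnSet (F : V → W) (S : Set V) : Prop :=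
  ∀ x ∈ S, ∃ U : Set V, IsOpen U ∧ x ∈ U ∧
    ∃ F' : V → W, ContDiffOn ℝ ∞ F' U ∧ EqOn F F' (S ∩ U)

/-- `F` restricts to a diffeomorphism from `S` onto `T`. -/
def IsDiffeo (F : V → W) (S : Set V) (T : Set W) : Prop :=
  BijOn F S T ∧ SmoothOnSet F S ∧ ∃ G : W → V, InvOn G F S T ∧ SmoothOnSet G T

/-- The tangent space of `S` at `x`: the velocities at `x` of smooth curves in `S`. -/
def tangentSet (S : Set V) (x : V) : Set V :=
  {v | ∃ γ : ℝ → V, ContDiff ℝ ∞ γ ∧ (∀ t, γ t ∈ S) ∧ γ 0 = x ∧ HasDerivAt γ v 0}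

/-- The differential at `x` of the map `F` on `S` sends the tangent vector `v` to `w`. -/
def MapsTangent (F : V → W) (S : Set V) (x : V) (v : V) (w : W) : Prop :=
  ∃ γ : ℝ → V, ContDiff ℝ ∞ γ ∧ (∀ t, γ t ∈ S) ∧ γ 0 = x ∧ HasDerivAt γ v 0 ∧
    HasDerivAt (F ∘ γ) w 0

/-- The image under the differential of `F` at `x` of the set `A` of tangent vectors at `x`. -/
def pushTangent (F : V → W) (S : Set V) (x : V) (A : Set V) : Set W :=
  {w | ∃ v ∈ A, MapsTangent F S x v w}

/-- `g` is a smooth Riemannian metric on the distribution `D` over `S` (only the restriction of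
`g x` to `D x`, for `x ∈ S`, matters). -/
structure IsMetricOn (g : V → V →L[ℝ] V →L[ℝ] ℝ) (S : Set V) (D : V → Set V) : Prop where
  smooth : SmoothOnSet g S
  symm : ∀ x ∈ S, ∀ u ∈ D x, ∀ v ∈ D x, g x u v = g x v u
  pos : ∀ x ∈ S, ∀ u ∈ D x, u ≠ 0 → 0 < g x u u

/-- The unit sphere bundle of `D` for the metric `g`, as a subset of the tangent bundle. -/
def sphereBundle (S : Set V) (D : V → Set V) (g : V → V →L[ℝ] V →L[ℝ] ℝ) : Set (V × V) :=
  {p | p.1 ∈ S ∧ p.2 ∈ D p.1 ∧ g p.1 p.2 p.2 = 1}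

/-- The spherical prolongation of `D`: at `(x, ν)` it consists of the tangent vectors of the unit
sphere bundle whose image under the differential of `(x, ν) ↦ x` is a multiple of `ν`. -/
def sphericalProlongation (S : Set V) (D : V → Set V) (g : V → V →L[ℝ] V →L[ℝ] ℝ)
    (p : V × V) : Set (V × V) :=
  {v | v ∈ tangentSet (sphereBundle S D g) p ∧ ∃ c : ℝ, v.1 = c • p.2}

end Extrinsic

/-- The Euclidean space of dimension `m + 1`. -/
abbrev E (m : ℕ) : Type := EuclideanSpace ℝ (Fin (m + 1))

/-! ### The tower of spherical prolongations -/

/-- The ambient vector space of the `j`-th stage of the tower. -/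
def Amb (m : ℕ) : ℕ → Type
  | 0 => E m
  | j + 1 => Amb m j × Amb m j

instance instNormedAddCommGroupAmb (m : ℕ) : ∀ j, NormedAddCommGroup (Amb m j)
  | 0 => inferInstanceAs (NormedAddCommGroup (E m))
  | j + 1 =>
    letI := instNormedAddCommGroupAmb m j
    inferInstanceAs (NormedAddCommGroup (Amb m j × Amb m j))

instance instNormedSpaceAmb (m : ℕ) : ∀ j, NormedSpace ℝ (Amb m j)
  | 0 => inferInstanceAs (NormedSpace ℝ (E m))
  | j + 1 =>
    letI := instNormedSpaceAmb m j
    inferInstanceAs (NormedSpace ℝ (Amb m j × Amb m j))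

/-- A choice of a field of bilinear forms on the ambient space of each stage. -/
abbrev Forms (m : ℕ) : Type :=
  (j : ℕ) → Amb m j → Amb m j →L[ℝ] Amb m j →L[ℝ] ℝ

/-- The stages of the tower: the manifold and its canonical distribution. -/
def tower (m : ℕ) (g : Forms m) : (j : ℕ) → Set (Amb m j) × (Amb m j → Set (Amb m j))
  | 0 => (univ, fun _ => univ)
  | j + 1 =>
    (sphereBundle (tower m g j).1 (tower m g j).2 (g j),
      sphericalProlongation (tower m g j).1 (tower m g j).2 (g j))

/-- The manifold obtained from `ℝ^(m+1)` after `k` spherical prolongations. -/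
def towerSpace (m : ℕ) (g : Forms m) (k : ℕ) : Set (Amb m k) := (tower m g k).1

/-- The canonical distribution on the `k`-th stage of the tower. -/
def towerDist (m : ℕ) (g : Forms m) (k : ℕ) : Amb m k → Set (Amb m k) := (tower m g k).2

/-- `g` consists of a smooth Riemannian metric on the canonical distribution of every stage. -/
def IsTowerMetric (m : ℕ) (g : Forms m) : Prop :=
  ∀ j, IsMetricOn (g j) (towerSpace m g j) (towerDist m g j)

/-- The projection `(x, ν) ↦ x` of the tower. -/
def towerProj (m k : ℕ) (p : Amb m (k + 1)) : Amb m k :=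
  Prod.fst (α := Amb m k) (β := Amb m k) p

/-! ### The articulated arm -/

/-- The configuration space of an arm with `k` bars of length one in `ℝ^(m+1)`. -/
def armSpace (m k : ℕ) : Set (Fin (k + 1) → E m) :=
  {x | ∀ i : Fin k, ‖x i.castSucc - x i.succ‖ = 1}

/-- The span at `x` of the fields `Z_i = ∑ r, (x_{i+1}^r - x_i^r) ∂/∂x_i^r`, `i < k`, and
`∂/∂x_k^r`. -/
def kinematicSpan (m k : ℕ) (x : Fin (k + 1) → E m) : Submodule ℝ (Fin (k + 1) → E m) :=
  Submodule.span ℝ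
    (range (fun i : Fin k =>
        (Pi.single i.castSucc (x i.succ - x i.castSucc) : Fin (k + 1) → E m)) ∪
      range (fun r : Fin (m + 1) =>
        (Pi.single (Fin.last k) (EuclideanSpace.single r (1 : ℝ)) : Fin (k + 1) → E m)))

/-- The kinematic distribution of the arm. -/
def armDist (m k : ℕ) (x : Fin (k + 1) → E m) : Set (Fin (k + 1) → E m) :=
  tangentSet (armSpace m k) x ∩ kinematicSpan m k x

/-- The projection forgetting the last point. -/
def armProj (m k : ℕ) (x : Fin (k + 2) → E m) : Fin (k + 1) → E m :=
  fun i => x i.castSucc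

end Arm

end

noncomputable section

namespace Arm

/-! ### Smooth maps on subsets and their differentials along curves -/

section Smooth

variable {V W X : Type*} [NormedAddCommGroup V] [NormedSpace ℝ V]
  [NormedAddCommGroup W] [NormedSpace ℝ W] [NormedAddCommGroup X] [NormedSpace ℝ X]

/-! A kinematic motion of the arm is determined by the velocity of its last point, which is
arbitrary. With unit bars `z_i = x_{i+1} - x_i`, a vector `u` lies in the distribution exactly when
`u_i = ⟨z_i, u_{i+1}⟩ z_i` for all `i` (`mem_armDist`), so `u` is recovered from its last component
backwards along the arm (`eq_kinematicLift`). Hence each fibre of the distribution is a copy of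
`ℝ^(m+1)`.

A unit vector of the distribution for any metric stands for a ray, that is, for a direction of the
last point. Attaching a unit bar in this direction gives the diffeomorphism of the next stage; the
metric enters only through the positive factor that normalises the inverse.

For the distributions, a tangent vector of the longer arm is kinematic iff its projection is
kinematic for the shorter arm and moves the old end along the new bar (`mem_armDist_succ_iff`). By
the same isomorphism, that projection is then a multiple of the image of `ν`, which is the condition
defining the spherical prolongation. `IsArmModel.prolong` is this induction step. -/

theorem smoothOnSet_of_contDiffOn {F : V → W} {S U : Set V} (hU : IsOpen U) (hSU : S ⊆ U)
    (hF : ContDiffOn ℝ ∞ F U) : SmoothOnSet F S :=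
  fun _ hx => ⟨U, hU, hSU hx, F, hF, fun _ _ => rfl⟩

theorem smoothOnSet_of_contDiff {F : V → W} {S : Set V} (hF : ContDiff ℝ ∞ F) : SmoothOnSet F S :=
  smoothOnSet_of_contDiffOn isOpen_univ (subset_univ _) hF.contDiffOn

theorem SmoothOnSet.mono {F : V → W} {S T : Set V} (hF : SmoothOnSet F T) (h : S ⊆ T) :
    SmoothOnSet F S := by
  intro x hx
  obtain ⟨U, hU, hxU, F', hF', he⟩ := hF x (h hx)
  exact ⟨U, hU, hxU, F', hF', he.mono (inter_subset_inter_left _ h)⟩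

theorem SmoothOnSet.comp {F : V → W} {G : W → X} {S : Set V} {T : Set W}
    (hG : SmoothOnSet G T) (hF : SmoothOnSet F S) (h : MapsTo F S T) :
    SmoothOnSet (fun x => G (F x)) S := by
  intro x hx
  obtain ⟨U, hU, hxU, F', hF', he⟩ := hF x hx
  obtain ⟨O, hO, hxO, G', hG', he'⟩ := hG (F x) (h hx)
  refine ⟨U ∩ F' ⁻¹' O, hF'.continuousOn.isOpen_inter_preimage hU hO, ⟨hxU, ?_⟩, fun y => G' (F' y),
    hG'.comp (hF'.mono inter_subset_left) (fun y hy => hy.2), ?_⟩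
  · rw [mem_preimage, ← he ⟨hx, hxU⟩]
    exact hxO
  · intro y hy
    have h1 : F y = F' y := he ⟨hy.1, hy.2.1⟩
    have h2 : F y ∈ O := h1 ▸ hy.2.2
    exact (he' ⟨h hy.1, h2⟩).trans (congrArg G' h1)

theorem SmoothOnSet.prodMk {F : V → W} {G : V → X} {S : Set V}
    (hF : SmoothOnSet F S) (hG : SmoothOnSet G S) : SmoothOnSet (fun x => (F x, G x)) S := by
  intro x hx
  obtain ⟨U, hU, hxU, F', hF', he⟩ := hF x hx
  obtain ⟨O, hO, hxO, G', hG', he'⟩ := hG x hx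
  refine ⟨U ∩ O, hU.inter hO, ⟨hxU, hxO⟩, fun y => (F' y, G' y),
    (hF'.mono inter_subset_left).prodMk (hG'.mono inter_subset_right), fun y hy => ?_⟩
  exact Prod.ext (he ⟨hy.1, hy.2.1⟩) (he' ⟨hy.1, hy.2.2⟩)

theorem SmoothOnSet.comp_curve {F : V → W} {S : Set V} (hF : SmoothOnSet F S) {γ : ℝ → V}
    (hγ : ContDiff ℝ ∞ γ) (hS : ∀ t, γ t ∈ S) : ContDiff ℝ ∞ (F ∘ γ) := by
  rw [contDiff_iff_contDiffAt]
  intro t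
  obtain ⟨U, hU, hxU, F', hF', he⟩ := hF (γ t) (hS t)
  have h1 : ContDiffAt ℝ ∞ (F' ∘ γ) t :=
    (hF'.contDiffAt (hU.mem_nhds hxU)).comp t hγ.contDiffAt
  refine h1.congr_of_eventuallyEq ?_
  filter_upwards [hγ.continuous.continuousAt.preimage_mem_nhds (hU.mem_nhds hxU)] with s hs
  exact he ⟨hS s, hs⟩

/-- The differential at `x` of the map `F` on `S`, as a function on tangent vectors. -/
def tangentMap (F : V → W) (S : Set V) (x v : V) : W :=
  Classical.epsilon (MapsTangent F S x v)

theorem hasDerivAt_comp_curve {F F' : V → W} {S U : Set V} {γ : ℝ → V} {x v : V}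
    (hU : IsOpen U) (hx : x ∈ U) (hF' : ContDiffOn ℝ ∞ F' U) (he : EqOn F F' (S ∩ U))
    (hS : ∀ t, γ t ∈ S) (h0 : γ 0 = x) (hv : HasDerivAt γ v 0) :
    HasDerivAt (F ∘ γ) (fderiv ℝ F' x v) 0 := by
  subst h0
  have h1 : HasFDerivAt F' (fderiv ℝ F' (γ 0)) (γ 0) :=
    ((hF'.contDiffAt (hU.mem_nhds hx)).differentiableAt (by simp)).hasFDerivAt
  refine (h1.comp_hasDerivAt 0 hv).congr_of_eventuallyEq ?_
  filter_upwards [hv.continuousAt.preimage_mem_nhds (hU.mem_nhds hx)] with s hs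
  exact he ⟨hS s, hs⟩

/-- By the chain rule any local smooth extension computes the differential, so it depends neither on
the curve nor on the extension. -/
theorem MapsTangent.eq_fderiv {F F' : V → W} {S U : Set V} {x v : V} {w : W}
    (h : MapsTangent F S x v w)
    (hU : IsOpen U) (hx : x ∈ U) (hF' : ContDiffOn ℝ ∞ F' U) (he : EqOn F F' (S ∩ U)) :
    w = fderiv ℝ F' x v := by
  obtain ⟨γ, -, hS, h0, hv, hw⟩ := h
  exact hw.unique (hasDerivAt_comp_curve hU hx hF' he hS h0 hv)

theorem MapsTangent.mem_tangentSet {F : V → W} {S : Set V} {x v : V} {w : W}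
    (h : MapsTangent F S x v w) : v ∈ tangentSet S x := by
  obtain ⟨γ, h1, hS, h0, hv, -⟩ := h
  exact ⟨γ, h1, hS, h0, hv⟩

theorem mem_of_mem_tangentSet {S : Set V} {x v : V} (h : v ∈ tangentSet S x) : x ∈ S := by
  obtain ⟨γ, -, hS, rfl, -⟩ := h
  exact hS 0

theorem MapsTangent.unique {F : V → W} {S : Set V} (hF : SmoothOnSet F S) {x v : V} {w w' : W}
    (h : MapsTangent F S x v w) (h' : MapsTangent F S x v w') : w = w' := by
  obtain ⟨U, hU, hxU, F', hF', he⟩ := hF x (mem_of_mem_tangentSet h.mem_tangentSet)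
  rw [h.eq_fderiv hU hxU hF' he, h'.eq_fderiv hU hxU hF' he]

theorem mapsTangent_tangentMap {F : V → W} {S : Set V} (hF : SmoothOnSet F S) {x v : V}
    (hv : v ∈ tangentSet S x) : MapsTangent F S x v (tangentMap F S x v) := by
  obtain ⟨U, hU, hxU, F', hF', he⟩ := hF x (mem_of_mem_tangentSet hv)
  obtain ⟨γ, h1, hS, h0, hv⟩ := hv
  exact Classical.epsilon_spec (p := MapsTangent F S x v)
    ⟨_, γ, h1, hS, h0, hv, hasDerivAt_comp_curve hU hxU hF' he hS h0 hv⟩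

theorem MapsTangent.tangentMap_eq {F : V → W} {S : Set V} (hF : SmoothOnSet F S) {x v : V} {w : W}
    (h : MapsTangent F S x v w) : tangentMap F S x v = w :=
  (mapsTangent_tangentMap hF h.mem_tangentSet).unique hF h

theorem SmoothOnSet.tangentMap {F : V → W} {S : Set V} (hF : SmoothOnSet F S) :
    SmoothOnSet (fun p : V × V => tangentMap F S p.1 p.2) {p | p.2 ∈ tangentSet S p.1} := by
  intro p hp
  obtain ⟨U, hU, hxU, F', hF', he⟩ := hF p.1 (mem_of_mem_tangentSet hp)
  refine ⟨U ×ˢ univ, hU.prod isOpen_univ, ⟨hxU, mem_univ _⟩, fun p => fderiv ℝ F' p.1 p.2, ?_, ?_⟩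
  · have h1 : ContDiffOn ℝ ∞ (fderiv ℝ F') U := hF'.fderiv_of_isOpen hU (by simp)
    exact (h1.comp contDiff_fst.contDiffOn (fun q hq => hq.1)).clm_apply contDiff_snd.contDiffOn
  · intro q hq
    exact (mapsTangent_tangentMap hF hq.1).eq_fderiv hU hq.2.1 hF' he

/-- Reparametrise the curve by `t ↦ c * t`. Homogeneity is the only part of linearity needed below,
and `c = 0` gives the constant curve. -/
theorem MapsTangent.smul {F : V → W} {S : Set V} {x v : V} {w : W}
    (h : MapsTangent F S x v w) (c : ℝ) : MapsTangent F S x (c • v) (c • w) := by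
  obtain ⟨γ, h1, hS, h0, hv, hw⟩ := h
  have hc : HasDerivAt (fun t : ℝ => c * t) c 0 := by
    simpa using (hasDerivAt_id (0 : ℝ)).const_mul c
  refine ⟨fun t => γ (c * t), h1.comp (contDiff_const.mul contDiff_id), fun t => hS _,
    by simpa using h0, ?_, ?_⟩
  · exact HasDerivAt.scomp (0 : ℝ) (by simpa using hv) hc
  · exact HasDerivAt.scomp (0 : ℝ) (by simpa using hw) hc

/-- The curve `F ∘ γ` is a witness, since `G` carries it back to `γ`. -/
theorem MapsTangent.inverse {F : V → W} {G : W → V} {S : Set V} {T : Set W}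
    (hF : SmoothOnSet F S) (hST : MapsTo F S T) (hGF : LeftInvOn G F S) {x v : V} {w : W}
    (h : MapsTangent F S x v w) : MapsTangent G T (F x) w v := by
  obtain ⟨γ, h1, hS, h0, hv, hw⟩ := h
  refine ⟨F ∘ γ, hF.comp_curve h1 hS, fun t => hST (hS t), congrArg F h0, hw, ?_⟩
  have : G ∘ F ∘ γ = γ := funext fun t => hGF (hS t)
  rwa [this]

theorem MapsTangent.mem_tangentSet_image {F : V → W} {S : Set V} {T : Set W}
    (hF : SmoothOnSet F S) (hST : MapsTo F S T) {x v : V} {w : W}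
    (h : MapsTangent F S x v w) : w ∈ tangentSet T (F x) := by
  obtain ⟨γ, h1, hS, h0, hv, hw⟩ := h
  exact ⟨F ∘ γ, hF.comp_curve h1 hS, fun t => hST (hS t), congrArg F h0, hw⟩

theorem tangentSet_univ (x : V) : tangentSet univ x = univ := by
  refine eq_univ_of_forall fun v => ⟨fun t => x + t • v, by fun_prop, fun _ => mem_univ _,
    by simp, ?_⟩
  simpa using ((hasDerivAt_id (0 : ℝ)).smul_const v).const_add x

end Smooth

/-! ### The arm: tangent vectors, kinematic distribution, lifting -/

section ArmSpace

variable {m : ℕ}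

/-- Differentiating the constant squared lengths gives necessity. For sufficiency an explicit curve
is built: move the first point linearly, move each bar along a normalised line, and add the bars up.
-/
theorem tangentSet_armSpace {k : ℕ} {q : Fin (k + 1) → E m} (hq : q ∈ armSpace m k)
    (u : Fin (k + 1) → E m) :
    u ∈ tangentSet (armSpace m k) q ↔
      ∀ i : Fin k, inner ℝ (q i.succ - q i.castSucc) (u i.succ - u i.castSucc) = 0 := by
  constructor
  · rintro ⟨γ, -, hS, rfl, hu⟩ i
    have hi := hasDerivAt_pi.1 hu
    have h1 := ((hi i.succ).sub (hi i.castSucc)).norm_sq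
    have h2 : (fun t => ‖γ t i.succ - γ t i.castSucc‖ ^ 2) = fun _ => (1 : ℝ) := by
      funext t
      rw [norm_sub_rev, hS t i, one_pow]
    have h3 := h1.unique (h2 ▸ hasDerivAt_const (0 : ℝ) (1 : ℝ))
    simpa using h3
  · intro h
    set z : Fin k → E m := fun i => q i.succ - q i.castSucc with hz
    set b : Fin k → E m := fun i => u i.succ - u i.castSucc
    have hz1 : ∀ i, ‖z i‖ = 1 := fun i => by rw [hz, norm_sub_rev]; exact hq i
    -- As `b i ⊥ z i`, the inner product with `z i` is constantly 1, so normalisation is possible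
    -- for every `t`.
    have hne : ∀ i (t : ℝ), z i + t • b i ≠ 0 := by
      intro i t h0
      have h1 : inner ℝ (z i) (z i + t • b i) = (1 : ℝ) := by
        rw [inner_add_right, inner_smul_right, h i, real_inner_self_eq_norm_sq, hz1]
        simp
      rw [h0, inner_zero_right] at h1
      exact zero_ne_one h1
    let ζ : Fin k → ℝ → E m := fun i t => ‖z i + t • b i‖⁻¹ • (z i + t • b i)
    have hζc : ∀ i, ContDiff ℝ ∞ (ζ i) := by
      intro i
      have h1 : ContDiff ℝ ∞ fun t : ℝ => z i + t • b i := by fun_prop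
      exact ((h1.norm ℝ (hne i)).inv fun t => norm_ne_zero_iff.2 (hne i t)).smul h1
    have hζn : ∀ i t, ‖ζ i t‖ = 1 := fun i t => by
      rw [norm_smul, norm_inv, norm_norm, inv_mul_cancel₀ (norm_ne_zero_iff.2 (hne i t))]
    have hζ0 : ∀ i, ζ i 0 = z i := fun i => by simp [ζ, hz1]
    have hζd : ∀ i, HasDerivAt (ζ i) (b i) 0 := by
      intro i
      have h1 : HasDerivAt (fun t : ℝ => z i + t • b i) (b i) 0 := by
        simpa using ((hasDerivAt_id (0 : ℝ)).smul_const (b i)).const_add (z i)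
      -- The length is stationary at 0, so normalising leaves the velocity `b i` unchanged.
      have h2 : HasDerivAt (fun t : ℝ => ‖z i + t • b i‖ ^ 2) 0 0 := by
        have hzb : inner ℝ (z i) (b i) = (0 : ℝ) := h i
        have := h1.norm_sq
        simpa [hzb] using this
      have h3 : HasDerivAt (fun t : ℝ => ‖z i + t • b i‖) 0 0 := by
        have := h2.sqrt (by simp [hz1])
        simpa using this
      have h4 : HasDerivAt (fun t : ℝ => ‖z i + t • b i‖⁻¹) 0 0 := by
        have := h3.fun_inv (by simp [hz1])
        simpa using this
      have := h4.fun_smul h1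
      simpa [ζ, hz1] using this
    -- The bars between point 0 and point `i`.
    let S : Fin (k + 1) → Finset (Fin k) := fun i => Finset.univ.filter fun j => j.castSucc < i
    have hS : ∀ i : Fin k, S i.succ = insert i (S i.castSucc) := by
      intro i
      ext j
      simp only [S, Finset.mem_filter, Finset.mem_univ, true_and, Finset.mem_insert]
      simp only [Fin.lt_def, Fin.ext_iff, Fin.val_castSucc, Fin.val_succ]
      omega
    have hS' : ∀ i : Fin k, i ∉ S i.castSucc := fun i => by simp [S]
    have hS0 : S 0 = ∅ := by simp [S]
    have tele : ∀ (f : Fin (k + 1) → E m) (i : Fin (k + 1)),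
        f i = f 0 + ∑ j ∈ S i, (f j.succ - f j.castSucc) := by
      intro f i
      induction i using Fin.induction with
      | zero => simp [hS0]
      | succ i ih =>
        rw [hS, Finset.sum_insert (hS' i), add_left_comm, ← ih]
        abel
    refine ⟨fun t i => q 0 + t • u 0 + ∑ j ∈ S i, ζ j t, ?_, ?_, ?_, ?_⟩
    · refine contDiff_pi.2 fun i => ContDiff.add (by fun_prop) (ContDiff.sum fun j _ => hζc j)
    · intro t i
      have : q 0 + t • u 0 + ∑ j ∈ S i.succ, ζ j t =
          ζ i t + (q 0 + t • u 0 + ∑ j ∈ S i.castSucc, ζ j t) := by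
        rw [hS, Finset.sum_insert (hS' i)]
        abel
      beta_reduce
      rw [this, norm_sub_rev, add_sub_cancel_right, hζn]
    · funext i
      simp only [zero_smul, add_zero, hζ0]
      exact (tele q i).symm
    · refine hasDerivAt_pi.2 fun i => ?_
      rw [tele u i]
      refine HasDerivAt.add ?_ (HasDerivAt.fun_sum fun j _ => hζd j)
      simpa using ((hasDerivAt_id (0 : ℝ)).smul_const (u 0)).const_add (q 0)

theorem mem_kinematicSpan {k : ℕ} (q u : Fin (k + 1) → E m) :
    u ∈ kinematicSpan m k q ↔
      ∀ i : Fin k, ∃ a : ℝ, u i.castSucc = a • (q i.succ - q i.castSucc) := by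
  constructor
  · intro h
    unfold kinematicSpan at h
    induction h using Submodule.span_induction with
    | mem x hx =>
      intro i
      rcases hx with ⟨j, rfl⟩ | ⟨r, rfl⟩
      · by_cases hij : i = j
        · subst hij
          exact ⟨1, by simp⟩
        · exact ⟨0, by simp [hij]⟩
      · exact ⟨0, by simp [Fin.castSucc_ne_last]⟩
    | zero => exact fun i => ⟨0, by simp⟩
    | add x y _ _ hx hy =>
      intro i
      obtain ⟨a, ha⟩ := hx i
      obtain ⟨b, hb⟩ := hy i
      exact ⟨a + b, by rw [Pi.add_apply, ha, hb, add_smul]⟩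
    | smul c x _ hx =>
      intro i
      obtain ⟨a, ha⟩ := hx i
      exact ⟨c * a, by rw [Pi.smul_apply, ha, mul_smul]⟩
  · intro h
    choose a ha using h
    have hlast : ∀ w : E m, (Pi.single (Fin.last k) w : Fin (k + 1) → E m) ∈
        kinematicSpan m k q := by
      intro w
      have hw : w = ∑ r, w r • EuclideanSpace.single r (1 : ℝ) := by
        ext s
        simp [Finset.sum_apply, Pi.single_apply]
      have hs : (Pi.single (Fin.last k) w : Fin (k + 1) → E m) =
          ∑ r, w r • Pi.single (Fin.last k) (EuclideanSpace.single r (1 : ℝ)) := by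
        conv_lhs => rw [hw]
        rw [← LinearMap.single_apply (R := ℝ) (φ := fun _ : Fin (k + 1) => E m), map_sum]
        refine Finset.sum_congr rfl fun r _ => ?_
        rw [map_smul, LinearMap.single_apply]
      rw [hs]
      exact Submodule.sum_mem _ fun r _ => Submodule.smul_mem _ _
        (Submodule.subset_span (Or.inr ⟨r, rfl⟩))
    rw [← Finset.univ_sum_single u, Fin.sum_univ_castSucc]
    refine Submodule.add_mem _ (Submodule.sum_mem _ fun i _ => ?_) (hlast _)
    rw [ha i, ← LinearMap.single_apply (R := ℝ) (φ := fun _ : Fin (k + 1) => E m), map_smul]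
    exact Submodule.smul_mem _ _ (Submodule.subset_span (Or.inl ⟨i, rfl⟩))

/-- The span makes `u_i` a multiple of the unit bar; tangency then forces the coefficient. -/
theorem mem_armDist {k : ℕ} {q : Fin (k + 1) → E m} (hq : q ∈ armSpace m k)
    (u : Fin (k + 1) → E m) :
    u ∈ armDist m k q ↔ ∀ i : Fin k,
      u i.castSucc =
        inner ℝ (q i.succ - q i.castSucc) (u i.succ) • (q i.succ - q i.castSucc) := by
  unfold armDist
  rw [mem_inter_iff, tangentSet_armSpace hq, SetLike.mem_coe, mem_kinematicSpan, ← forall_and]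
  refine forall_congr' fun i => ?_
  have hz : inner ℝ (q i.succ - q i.castSucc) (q i.succ - q i.castSucc) = (1 : ℝ) := by
    rw [real_inner_self_eq_norm_sq, norm_sub_rev, hq i, one_pow]
  constructor
  · rintro ⟨h, a, ha⟩
    rw [ha, inner_sub_right, inner_smul_right, hz, mul_one, sub_eq_zero] at h
    rw [ha, h]
  · intro h
    refine ⟨?_, _, h⟩
    rw [h, inner_sub_right, inner_smul_right, hz, mul_one, sub_self]

/-- The vector of the kinematic distribution at `q` with prescribed last component. -/
def kinematicLift : (k : ℕ) → (Fin (k + 1) → E m) → E m → (Fin (k + 1) → E m)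
  | 0, _, w => fun _ => w
  | k + 1, q, w =>
    let z := q (Fin.last (k + 1)) - q (Fin.last k).castSucc
    Fin.snoc (α := fun _ => E m) (kinematicLift k (armProj m k q) (inner ℝ z w • z)) w

theorem kinematicLift_last (k : ℕ) (q : Fin (k + 1) → E m) (w : E m) :
    kinematicLift k q w (Fin.last k) = w := by
  cases k with
  | zero => rfl
  | succ k => simp [kinematicLift]

theorem armProj_mem {k : ℕ} {q : Fin (k + 2) → E m} (hq : q ∈ armSpace m (k + 1)) :
    armProj m k q ∈ armSpace m k := fun i => hq i.castSucc

theorem kinematicLift_smul (k : ℕ) (q : Fin (k + 1) → E m) (c : ℝ) (w : E m) :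
    kinematicLift k q (c • w) = c • kinematicLift k q w := by
  induction k generalizing w with
  | zero => rfl
  | succ k ih =>
    funext i
    refine Fin.lastCases ?_ (fun i => ?_) i
    · simp [kinematicLift]
    · simp [kinematicLift, inner_smul_right, mul_smul, ih]

theorem kinematicLift_mem {k : ℕ} {q : Fin (k + 1) → E m} (hq : q ∈ armSpace m k) (w : E m) :
    kinematicLift k q w ∈ armDist m k q := by
  induction k generalizing w with
  | zero => exact (mem_armDist hq _).2 fun i => i.elim0
  | succ k ih =>
    refine (mem_armDist hq _).2 fun i => ?_
    refine Fin.lastCases ?_ (fun i => ?_) i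
    · rw [Fin.succ_last, kinematicLift_last]
      simp only [kinematicLift, Fin.snoc_castSucc, kinematicLift_last]
    · rw [Fin.succ_castSucc]
      simp only [kinematicLift, Fin.snoc_castSucc]
      exact (mem_armDist (armProj_mem hq) _).1 (ih (armProj_mem hq) _) i

/-- Both sides obey the recursion of `mem_armDist`, which determines each component from the next.
-/
theorem eq_kinematicLift {k : ℕ} {q u : Fin (k + 1) → E m} (hq : q ∈ armSpace m k)
    (hu : u ∈ armDist m k q) : u = kinematicLift k q (u (Fin.last k)) := by
  rw [mem_armDist hq] at hu
  have hv := (mem_armDist hq _).1 (kinematicLift_mem hq (u (Fin.last k)))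
  funext i
  induction i using Fin.reverseInduction with
  | last => rw [kinematicLift_last]
  | cast i ih => rw [hu i, hv i, ih]

theorem contDiff_snoc {V : Type*} [NormedAddCommGroup V] [NormedSpace ℝ V] {k : ℕ}
    {f : V → Fin k → E m} {h : V → E m} (hf : ContDiff ℝ ∞ f) (hh : ContDiff ℝ ∞ h) :
    ContDiff ℝ ∞ fun x => (Fin.snoc (α := fun _ => E m) (f x) (h x) : Fin (k + 1) → E m) := by
  refine contDiff_pi.2 fun i => ?_
  refine Fin.lastCases ?_ (fun i => ?_) i
  · simpa using hh
  · simpa using contDiff_pi.1 hf i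

theorem contDiff_armProj (k : ℕ) : ContDiff ℝ ∞ (armProj m k) :=
  contDiff_pi.2 fun i => contDiff_apply ℝ (E m) i.castSucc

theorem contDiff_kinematicLift (k : ℕ) :
    ContDiff ℝ ∞ fun p : (Fin (k + 1) → E m) × E m => kinematicLift k p.1 p.2 := by
  induction k with
  | zero => exact contDiff_pi.2 fun _ => contDiff_snd
  | succ k ih =>
    have hz : ContDiff ℝ ∞ fun p : (Fin (k + 2) → E m) × E m =>
        p.1 (Fin.last (k + 1)) - p.1 (Fin.last k).castSucc := by fun_prop
    refine contDiff_snoc (ih.comp (((contDiff_armProj k).comp contDiff_fst).prodMk ?_)) contDiff_snd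
    exact (hz.inner ℝ contDiff_snd).smul hz

end ArmSpace

/-! ### Prolonging an identification with an arm space -/

section Prolongation

variable {m : ℕ} {V : Type*} [NormedAddCommGroup V] [NormedSpace ℝ V]

/-- The map from the unit sphere bundle over `S` to the arm with one more bar that is induced by a
map `F` from `S` to an arm space: the new bar points in the direction in which the differential of
`F` moves the last point. -/
def prolongMap (k : ℕ) (F : V → Fin (k + 1) → E m) (S : Set V) (p : V × V) : Fin (k + 2) → E m :=
  Fin.snoc (α := fun _ => E m) (F p.1)
    (F p.1 (Fin.last k) + ‖tangentMap F S p.1 p.2 (Fin.last k)‖⁻¹ •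
      tangentMap F S p.1 p.2 (Fin.last k))

/-- The unnormalised direction in `S` along which the last point of the shorter arm moves in the
direction of the last bar. -/
def liftDirection (k : ℕ) (G : (Fin (k + 1) → E m) → V) (q : Fin (k + 2) → E m) : V :=
  tangentMap G (armSpace m k) (armProj m k q)
    (kinematicLift k (armProj m k q) (q (Fin.last (k + 1)) - q (Fin.last k).castSucc))

/-- The inverse of `prolongMap`. -/
def prolongInv (k : ℕ) (G : (Fin (k + 1) → E m) → V) (g : V → V →L[ℝ] V →L[ℝ] ℝ)
    (q : Fin (k + 2) → E m) : V × V :=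
  (G (armProj m k q),
    (√(g (G (armProj m k q)) (liftDirection k G q) (liftDirection k G q)))⁻¹ • liftDirection k G q)

@[simp]
theorem armProj_prolongMap (k : ℕ) (F : V → Fin (k + 1) → E m) (S : Set V) (p : V × V) :
    armProj m k (prolongMap k F S p) = F p.1 := by
  funext i
  simp [armProj, prolongMap]

/-- This differentiates the commuting square of the two projections along a curve. -/
theorem MapsTangent.armProj_fst {k : ℕ} {F : V → Fin (k + 1) → E m} {S : Set V} {T : Set (V × V)}
    (hT : ∀ p ∈ T, p.1 ∈ S) {p v : V × V} {w : Fin (k + 2) → E m}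
    (h : MapsTangent (prolongMap k F S) T p v w) :
    MapsTangent F S p.1 v.1 (armProj m k w) := by
  obtain ⟨γ, h1, hS, rfl, hv, hw⟩ := h
  refine ⟨fun t => (γ t).1, contDiff_fst.comp h1, fun t => hT _ (hS t), rfl, ?_, ?_⟩
  · exact (hasFDerivAt_fst (𝕜 := ℝ) (p := γ 0)).comp_hasDerivAt 0 hv
  · refine hasDerivAt_pi.2 fun i => ?_
    have := hasDerivAt_pi.1 hw i.castSucc
    simpa [Function.comp_def, prolongMap, armProj] using this

/-- `F` is a diffeomorphism from `S` onto an arm space, with inverse `G`, that carries the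
distribution `D` to the kinematic distribution. -/
structure IsArmModel (k : ℕ) (F : V → Fin (k + 1) → E m) (G : (Fin (k + 1) → E m) → V)
    (S : Set V) (D : V → Set V) : Prop where
  mapsTo : MapsTo F S (armSpace m k)
  mapsTo_inv : MapsTo G (armSpace m k) S
  invOn : InvOn G F S (armSpace m k)
  smooth : SmoothOnSet F S
  smooth_inv : SmoothOnSet G (armSpace m k)
  dist_subset : ∀ x ∈ S, D x ⊆ tangentSet S x
  push : ∀ x ∈ S, pushTangent F S x (D x) = armDist m k (F x)

namespace IsArmModel

variable {k : ℕ} {F : V → Fin (k + 1) → E m} {G : (Fin (k + 1) → E m) → V}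
  {S : Set V} {D : V → Set V} {g : V → V →L[ℝ] V →L[ℝ] ℝ}

theorem isDiffeo (h : IsArmModel k F G S D) : IsDiffeo F S (armSpace m k) :=
  ⟨h.invOn.bijOn h.mapsTo h.mapsTo_inv, h.smooth, G, h.invOn, h.smooth_inv⟩

theorem inverse_mapsTangent (h : IsArmModel k F G S D) {q w : Fin (k + 1) → E m} {v : V}
    (hw : MapsTangent G (armSpace m k) q w v) : MapsTangent F S (G q) v w :=
  hw.inverse h.smooth_inv h.mapsTo_inv h.invOn.2

theorem mapsTangent_inverse (h : IsArmModel k F G S D) {x v : V} {w : Fin (k + 1) → E m}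
    (hv : MapsTangent F S x v w) : MapsTangent G (armSpace m k) (F x) w v :=
  hv.inverse h.smooth h.mapsTo h.invOn.1

theorem mapsTangent_injective (h : IsArmModel k F G S D) {x v v' : V} {w : Fin (k + 1) → E m}
    (hv : MapsTangent F S x v w) (hv' : MapsTangent F S x v' w) : v = v' :=
  (h.mapsTangent_inverse hv).unique h.smooth_inv (h.mapsTangent_inverse hv')

theorem mapsTangent_of_mem (h : IsArmModel k F G S D) {x v : V} (hx : x ∈ S) (hv : v ∈ D x) :
    MapsTangent F S x v (tangentMap F S x v) :=
  mapsTangent_tangentMap h.smooth (h.dist_subset x hx hv)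

/-- Injectivity of the differential upgrades the equality of sets in `push` to a pointwise
criterion. -/
theorem mem_dist_iff (h : IsArmModel k F G S D) {x v : V} {w : Fin (k + 1) → E m} (hx : x ∈ S)
    (hv : MapsTangent F S x v w) : v ∈ D x ↔ w ∈ armDist m k (F x) := by
  rw [← h.push x hx]
  constructor
  · exact fun hD => ⟨v, hD, hv⟩
  · rintro ⟨v', hD, hv'⟩
    rwa [h.mapsTangent_injective hv hv']

theorem tangentMap_eq_lift (h : IsArmModel k F G S D) {x v : V} (hx : x ∈ S) (hv : v ∈ D x) :
    tangentMap F S x v = kinematicLift k (F x) (tangentMap F S x v (Fin.last k)) :=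
  eq_kinematicLift (h.mapsTo hx) ((h.mem_dist_iff hx (h.mapsTangent_of_mem hx hv)).1 hv)

/-- A kinematic vector with zero last component vanishes, and the differential is injective. This
makes the direction of the new bar well defined. -/
theorem last_ne_zero (h : IsArmModel k F G S D) {x v : V} (hx : x ∈ S) (hv : v ∈ D x)
    (hv0 : v ≠ 0) : tangentMap F S x v (Fin.last k) ≠ 0 := by
  intro h0
  have h1 := h.tangentMap_eq_lift hx hv
  have h2 := h.mapsTangent_of_mem hx hv
  rw [h0, ← zero_smul ℝ (0 : E m), kinematicLift_smul, zero_smul] at h1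
  rw [h1] at h2
  have h3 := h2.smul 0
  rw [zero_smul, zero_smul] at h3
  exact hv0 (h.mapsTangent_injective h2 h3)

theorem mapsTangent_liftDirection (h : IsArmModel k F G S D) {q : Fin (k + 2) → E m}
    (hq : q ∈ armSpace m (k + 1)) :
    MapsTangent F S (G (armProj m k q)) (liftDirection k G q) (kinematicLift k (armProj m k q)
      (q (Fin.last (k + 1)) - q (Fin.last k).castSucc)) :=
  h.inverse_mapsTangent
    (mapsTangent_tangentMap h.smooth_inv (kinematicLift_mem (armProj_mem hq) _).1)

theorem liftDirection_mem (h : IsArmModel k F G S D) {q : Fin (k + 2) → E m}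
    (hq : q ∈ armSpace m (k + 1)) (c : ℝ) : c • liftDirection k G q ∈ D (G (armProj m k q)) := by
  have h1 := (h.mapsTangent_liftDirection hq).smul c
  rw [h.mem_dist_iff (h.mapsTo_inv (armProj_mem hq)) h1, h.invOn.2 (armProj_mem hq),
    ← kinematicLift_smul]
  exact kinematicLift_mem (armProj_mem hq) _

theorem norm_last_bar {q : Fin (k + 2) → E m} (hq : q ∈ armSpace m (k + 1)) :
    ‖q (Fin.last (k + 1)) - q (Fin.last k).castSucc‖ = 1 := by
  rw [norm_sub_rev]
  exact hq (Fin.last k)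

theorem liftDirection_ne_zero (h : IsArmModel k F G S D) {q : Fin (k + 2) → E m}
    (hq : q ∈ armSpace m (k + 1)) : liftDirection k G q ≠ 0 := by
  intro h0
  have h1 := h.mapsTangent_liftDirection hq
  have h2 := h1.smul 0
  rw [zero_smul, ← h0] at h2
  have h3 := congrFun (h1.unique h.smooth h2) (Fin.last k)
  rw [zero_smul, kinematicLift_last] at h3
  have h4 := norm_last_bar hq
  rw [h3, Pi.zero_apply, norm_zero] at h4
  exact zero_ne_one h4

theorem metric_liftDirection_pos (h : IsArmModel k F G S D) (hg : IsMetricOn g S D)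
    {q : Fin (k + 2) → E m} (hq : q ∈ armSpace m (k + 1)) :
    0 < g (G (armProj m k q)) (liftDirection k G q) (liftDirection k G q) :=
  hg.pos _ (h.mapsTo_inv (armProj_mem hq)) _ (by simpa using h.liftDirection_mem hq 1)
    (h.liftDirection_ne_zero hq)

theorem ne_zero_of_mem_sphereBundle {p : V × V} (hp : p ∈ sphereBundle S D g) : p.2 ≠ 0 := by
  intro h0
  have h1 := hp.2.2
  rw [h0, map_zero] at h1
  exact zero_ne_one h1

/-! ### Bijectivity of the prolonged map -/

theorem prolong_mapsTo (h : IsArmModel k F G S D) :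
    MapsTo (prolongMap k F S) (sphereBundle S D g) (armSpace m (k + 1)) := by
  intro p hp i
  refine Fin.lastCases ?_ (fun i => ?_) i
  · have h0 := h.last_ne_zero hp.1 hp.2.1 (ne_zero_of_mem_sphereBundle hp)
    rw [Fin.succ_last]
    simp only [prolongMap, Fin.snoc_castSucc, Fin.snoc_last]
    rw [norm_sub_rev, add_sub_cancel_left, norm_smul, norm_inv, norm_norm,
      inv_mul_cancel₀ (norm_ne_zero_iff.2 h0)]
  · rw [Fin.succ_castSucc]
    simp only [prolongMap, Fin.snoc_castSucc]
    exact h.mapsTo hp.1 i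

theorem prolongInv_mapsTo (h : IsArmModel k F G S D) (hg : IsMetricOn g S D) :
    MapsTo (prolongInv k G g) (armSpace m (k + 1)) (sphereBundle S D g) := by
  intro q hq
  refine ⟨h.mapsTo_inv (armProj_mem hq), h.liftDirection_mem hq _, ?_⟩
  have h0 := h.metric_liftDirection_pos hg hq
  simp only [prolongInv, map_smul, smul_apply, smul_eq_mul]
  have h1 := Real.mul_self_sqrt h0.le
  have h2 := (Real.sqrt_pos.2 h0).ne'
  field_simp
  rw [sq, h1]

/-- The differential of `F` sends both sides to the kinematic lift of the new bar. -/
theorem liftDirection_prolongMap (h : IsArmModel k F G S D) {p : V × V}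
    (hp : p ∈ sphereBundle S D g) :
    liftDirection k G (prolongMap k F S p) =
      ‖tangentMap F S p.1 p.2 (Fin.last k)‖⁻¹ • p.2 := by
  have h1 := (h.mapsTangent_of_mem hp.1 hp.2.1).smul ‖tangentMap F S p.1 p.2 (Fin.last k)‖⁻¹
  have h2 := h.mapsTangent_liftDirection (h.prolong_mapsTo hp)
  rw [armProj_prolongMap, h.invOn.1 hp.1] at h2
  refine h.mapsTangent_injective h2 ?_
  rw [h.tangentMap_eq_lift hp.1 hp.2.1, ← kinematicLift_smul, kinematicLift_last] at h1
  simpa [prolongMap] using h1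

theorem prolong_leftInvOn (h : IsArmModel k F G S D) :
    LeftInvOn (prolongInv k G g) (prolongMap k F S) (sphereBundle S D g) := by
  intro p hp
  have h0 := h.last_ne_zero hp.1 hp.2.1 (ne_zero_of_mem_sphereBundle hp)
  have h1 : 0 < ‖tangentMap F S p.1 p.2 (Fin.last k)‖⁻¹ := inv_pos.2 (norm_pos_iff.2 h0)
  have h2 : g p.1 p.2 p.2 = 1 := hp.2.2
  unfold prolongInv
  rw [h.liftDirection_prolongMap hp, armProj_prolongMap, h.invOn.1 hp.1]
  simp only [map_smul, smul_apply, smul_eq_mul, h2, mul_one,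
    Real.sqrt_mul_self h1.le, smul_smul, inv_mul_cancel₀ h1.ne', one_smul]

theorem prolong_rightInvOn (h : IsArmModel k F G S D) (hg : IsMetricOn g S D) :
    RightInvOn (prolongInv k G g) (prolongMap k F S) (armSpace m (k + 1)) := by
  intro q hq
  have h0 : 0 < (√(g (G (armProj m k q)) (liftDirection k G q) (liftDirection k G q)))⁻¹ :=
    inv_pos.2 (Real.sqrt_pos.2 (h.metric_liftDirection_pos hg hq))
  have h1 := ((h.mapsTangent_liftDirection hq).smul _).tangentMap_eq h.smooth
    (v := (√(g (G (armProj m k q)) (liftDirection k G q) (liftDirection k G q)))⁻¹ •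
      liftDirection k G q)
  unfold prolongMap prolongInv
  simp only
  rw [h1, h.invOn.2 (armProj_mem hq), ← kinematicLift_smul, kinematicLift_last, norm_smul,
    norm_last_bar hq, mul_one, Real.norm_of_nonneg h0.le, smul_smul, inv_mul_cancel₀ h0.ne',
    one_smul]
  funext i
  refine Fin.lastCases ?_ (fun i => ?_) i
  · simp [armProj]
  · simp [armProj]

/-! ### Smoothness of the prolonged map and its inverse -/

theorem prolong_smooth (h : IsArmModel k F G S D) :
    SmoothOnSet (prolongMap k F S) (sphereBundle S D g) := by
  have h1 : SmoothOnSet (fun p : V × V => F p.1) (sphereBundle S D g) :=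
    h.smooth.comp (smoothOnSet_of_contDiff contDiff_fst) fun p hp => hp.1
  have h2 : SmoothOnSet (fun p : V × V => tangentMap F S p.1 p.2) (sphereBundle S D g) :=
    h.smooth.tangentMap.mono fun p hp => h.dist_subset _ hp.1 hp.2.1
  -- Normalisation is smooth off zero, and `last_ne_zero` keeps the pair (point, image of `ν`) in
  -- this open set.
  let U : Set ((Fin (k + 1) → E m) × (Fin (k + 1) → E m)) := {r | r.2 (Fin.last k) ≠ 0}
  have hU : IsOpen U :=
    isOpen_compl_singleton.preimage ((continuous_apply (Fin.last k)).comp continuous_snd)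
  let Φ : (Fin (k + 1) → E m) × (Fin (k + 1) → E m) → Fin (k + 2) → E m := fun r =>
    Fin.snoc (α := fun _ => E m) r.1
      (r.1 (Fin.last k) + ‖r.2 (Fin.last k)‖⁻¹ • r.2 (Fin.last k))
  have hΦ : ContDiffOn ℝ ∞ Φ U := by
    refine contDiffOn_pi.2 fun i => ?_
    refine Fin.lastCases ?_ (fun i => ?_) i
    · simp only [Φ, Fin.snoc_last]
      have h3 : ContDiff ℝ ∞ fun r : (Fin (k + 1) → E m) × (Fin (k + 1) → E m) =>
          r.2 (Fin.last k) := by fun_prop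
      have h4 : ContDiff ℝ ∞ fun r : (Fin (k + 1) → E m) × (Fin (k + 1) → E m) =>
          r.1 (Fin.last k) := by fun_prop
      exact h4.contDiffOn.add (((h3.contDiffOn.norm ℝ fun r hr => hr).inv fun r hr =>
        norm_ne_zero_iff.2 hr).smul h3.contDiffOn)
    · simp only [Φ, Fin.snoc_castSucc]
      exact ContDiff.contDiffOn (by fun_prop)
  exact (smoothOnSet_of_contDiffOn hU subset_rfl hΦ).comp (h1.prodMk h2) fun p hp =>
    h.last_ne_zero hp.1 hp.2.1 (ne_zero_of_mem_sphereBundle hp)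

theorem prolongInv_smooth (h : IsArmModel k F G S D) (hg : IsMetricOn g S D) :
    SmoothOnSet (prolongInv k G g) (armSpace m (k + 1)) := by
  have h1 : SmoothOnSet (fun q => G (armProj m k q)) (armSpace m (k + 1)) :=
    h.smooth_inv.comp (smoothOnSet_of_contDiff (contDiff_armProj k)) fun q hq => armProj_mem hq
  have hl : ContDiff ℝ ∞ fun q : Fin (k + 2) → E m =>
      kinematicLift k (armProj m k q) (q (Fin.last (k + 1)) - q (Fin.last k).castSucc) :=
    (contDiff_kinematicLift k).comp ((contDiff_armProj k).prodMk (by fun_prop))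
  have h2 : SmoothOnSet (liftDirection k G) (armSpace m (k + 1)) :=
    h.smooth_inv.tangentMap.comp (smoothOnSet_of_contDiff ((contDiff_armProj k).prodMk hl))
      fun q hq => (kinematicLift_mem (armProj_mem hq) _).1
  have h3 : SmoothOnSet (fun q => g (G (armProj m k q))) (armSpace m (k + 1)) :=
    hg.smooth.comp h1 fun q hq => h.mapsTo_inv (armProj_mem hq)
  have hc : ContDiff ℝ ∞ fun r : (V →L[ℝ] V →L[ℝ] ℝ) × V => r.1 r.2 r.2 :=
    (contDiff_fst.clm_apply contDiff_snd).clm_apply contDiff_snd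
  have hΦ : ContDiffOn ℝ ∞ (fun r : (V →L[ℝ] V →L[ℝ] ℝ) × V => (√(r.1 r.2 r.2))⁻¹ • r.2)
      {r | 0 < r.1 r.2 r.2} := by
    refine ContDiffOn.smul ?_ contDiff_snd.contDiffOn
    exact (hc.contDiffOn.sqrt fun r hr => (ne_of_gt hr)).inv fun r hr =>
      (Real.sqrt_pos.2 hr).ne'
  exact h1.prodMk ((smoothOnSet_of_contDiffOn (isOpen_Ioi.preimage hc.continuous)
    subset_rfl hΦ).comp (h3.prodMk h2) fun q hq => h.metric_liftDirection_pos hg hq)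

/-! ### Correspondence of the distributions -/

theorem mem_armDist_succ_iff {q w : Fin (k + 2) → E m} (hq : q ∈ armSpace m (k + 1)) :
    w ∈ armDist m (k + 1) q ↔ w ∈ tangentSet (armSpace m (k + 1)) q ∧
      armProj m k w ∈ armDist m k (armProj m k q) ∧
      ∃ a : ℝ, w (Fin.last k).castSucc =
        a • (q (Fin.last (k + 1)) - q (Fin.last k).castSucc) := by
  constructor
  · intro hw
    refine ⟨hw.1, ?_, ?_⟩
    · rw [mem_armDist (armProj_mem hq)]
      exact fun i => (mem_armDist hq w).1 hw i.castSucc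
    · exact (mem_kinematicSpan q w).1 hw.2 (Fin.last k)
  · rintro ⟨h1, h2, h3⟩
    refine ⟨h1, (mem_kinematicSpan q w).2 fun i => ?_⟩
    refine Fin.lastCases h3 (fun i => ?_) i
    exact (mem_kinematicSpan _ _).1 h2.2 i

theorem prolong_push (h : IsArmModel k F G S D) (hg : IsMetricOn g S D) {p : V × V}
    (hp : p ∈ sphereBundle S D g) :
    pushTangent (prolongMap k F S) (sphereBundle S D g) p (sphericalProlongation S D g p) =
      armDist m (k + 1) (prolongMap k F S p) := by
  set A := tangentMap F S p.1 p.2 with hA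
  have hA0 : A (Fin.last k) ≠ 0 :=
    h.last_ne_zero hp.1 hp.2.1 (ne_zero_of_mem_sphereBundle hp)
  have hr : ‖A (Fin.last k)‖ ≠ 0 := norm_ne_zero_iff.2 hA0
  have hAm : MapsTangent F S p.1 p.2 A := h.mapsTangent_of_mem hp.1 hp.2.1
  have hAl : A = kinematicLift k (F p.1) (A (Fin.last k)) := h.tangentMap_eq_lift hp.1 hp.2.1
  have hbar : prolongMap k F S p (Fin.last (k + 1)) -
      prolongMap k F S p (Fin.last k).castSucc = ‖A (Fin.last k)‖⁻¹ • A (Fin.last k) := by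
    simp [prolongMap, hA]
  have hfst : ∀ p ∈ sphereBundle S D g, p.1 ∈ S := fun p hp => hp.1
  have hq := h.prolong_mapsTo hp
  ext w
  rw [mem_armDist_succ_iff hq, armProj_prolongMap, hbar]
  constructor
  · rintro ⟨v, ⟨-, c, hc⟩, hvw⟩
    have h1 := hvw.armProj_fst hfst
    rw [hc] at h1
    have h2 : armProj m k w = c • A := h1.unique h.smooth (hAm.smul c)
    -- The old end moves with velocity `c • A (Fin.last k)`, and the new bar is that vector `A
    -- (Fin.last k)` divided by its norm.
    refine ⟨hvw.mem_tangentSet_image h.prolong_smooth h.prolong_mapsTo, ?_,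
      c * ‖A (Fin.last k)‖, ?_⟩
    · rw [h2, hAl, ← kinematicLift_smul]
      exact kinematicLift_mem (h.mapsTo hp.1) _
    · rw [smul_smul, mul_assoc, mul_inv_cancel₀ hr, mul_one]
      exact congrFun h2 (Fin.last k)
  · rintro ⟨h1, h2, a, ha⟩
    -- The differential of the inverse supplies a preimage of `w`; it remains to see that its first
    -- component is a multiple of `ν`.
    have h3 := mapsTangent_tangentMap (h.prolongInv_smooth hg) h1
    have h4 := h3.inverse (h.prolongInv_smooth hg) (h.prolongInv_mapsTo hg)
      (h.prolong_rightInvOn hg)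
    rw [h.prolong_leftInvOn hp] at h4
    refine ⟨_, ⟨h4.mem_tangentSet, a * ‖A (Fin.last k)‖⁻¹, ?_⟩, h4⟩
    -- Both sides are kinematic with the same last component, so they agree.
    have h5 : armProj m k w = (a * ‖A (Fin.last k)‖⁻¹) • A := by
      have h6 := eq_kinematicLift (h.mapsTo hp.1) h2
      have h7 : armProj m k w (Fin.last k) = (a * ‖A (Fin.last k)‖⁻¹) • A (Fin.last k) := by
        rw [← smul_smul]
        exact ha
      rwa [h7, kinematicLift_smul, ← hAl] at h6
    refine h.mapsTangent_injective (h4.armProj_fst hfst) ?_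
    rw [h5]
    exact hAm.smul _

theorem prolong (h : IsArmModel k F G S D) (hg : IsMetricOn g S D) :
    IsArmModel (k + 1) (prolongMap k F S) (prolongInv k G g) (sphereBundle S D g)
      (sphericalProlongation S D g) where
  mapsTo := h.prolong_mapsTo
  mapsTo_inv := h.prolongInv_mapsTo hg
  invOn := ⟨h.prolong_leftInvOn, h.prolong_rightInvOn hg⟩
  smooth := h.prolong_smooth
  smooth_inv := h.prolongInv_smooth hg
  dist_subset := fun _ _ _ hv => hv.1
  push := fun _ hp => h.prolong_push hg hp

end IsArmModel

/-! ### Base case and the induction along the tower -/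

theorem isArmModel_zero (m : ℕ) :
    IsArmModel (m := m) 0 (fun (x : E m) _ => x) (fun q => q 0) univ (fun _ => univ) where
  mapsTo := fun _ _ i => i.elim0
  mapsTo_inv := fun _ _ => mem_univ _
  invOn := ⟨fun _ _ => rfl, fun q _ => funext fun i => by rw [Fin.fin_one_eq_zero i]⟩
  smooth := smoothOnSet_of_contDiff (contDiff_pi.2 fun _ => contDiff_id)
  smooth_inv := smoothOnSet_of_contDiff (contDiff_apply ℝ (E m) 0)
  dist_subset := fun x _ => (tangentSet_univ x).ge
  push := by
    intro x _
    ext w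
    refine ⟨fun _ => (mem_armDist (fun i => i.elim0) w).2 fun i => i.elim0, fun _ => ?_⟩
    have hw : w (0 : Fin 1) ∈ tangentSet univ x := by rw [tangentSet_univ]; trivial
    obtain ⟨γ, h1, hS, h0, hv⟩ := hw
    refine ⟨w 0, mem_univ _, γ, h1, hS, h0, hv, hasDerivAt_pi.2 fun i => ?_⟩
    obtain rfl : i = 0 := Fin.fin_one_eq_zero i
    exact hv

end Prolongation

/-- The identification of the stages of the tower with the configuration spaces of arms. -/
def towerToArm (m : ℕ) (g : Forms m) : (k : ℕ) → Amb m k → (Fin (k + 1) → E m)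
  | 0 => fun x _ => x
  | k + 1 => prolongMap (V := Amb m k) k (towerToArm m g k) (towerSpace m g k)

theorem exists_isArmModel_towerToArm {m : ℕ} {g : Forms m} (hg : IsTowerMetric m g) (k : ℕ) :
    ∃ G, IsArmModel k (towerToArm m g k) G (towerSpace m g k) (towerDist m g k) := by
  induction k with
  | zero => exact ⟨_, isArmModel_zero m⟩
  | succ k ih =>
    obtain ⟨G, hG⟩ := ih
    exact ⟨_, hG.prolong (hg k)⟩

end Arm

end

theorem theorem1 (m : ℕ) (hm : 2 ≤ m) (g : Arm.Forms m) (hg : Arm.IsTowerMetric m g) :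
    ∃ F : (k : ℕ) → Arm.Amb m k → (Fin (k + 1) → Arm.E m),
      (∀ x : Arm.E m, F 0 x = fun _ => x) ∧
      ∀ k : ℕ,
        Arm.IsDiffeo (F (k + 1)) (Arm.towerSpace m g (k + 1)) (Arm.armSpace m (k + 1)) ∧
        (∀ p ∈ Arm.towerSpace m g (k + 1),
          Arm.armProj m k (F (k + 1) p) = F k (Arm.towerProj m k p)) ∧
        (∀ p ∈ Arm.towerSpace m g (k + 1),
          Arm.pushTangent (F (k + 1)) (Arm.towerSpace m g (k + 1)) p
              (Arm.towerDist m g (k + 1) p) =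
            Arm.armDist m (k + 1) (F (k + 1) p)) := by
  refine ⟨Arm.towerToArm m g, fun _ => rfl, fun k => ?_⟩
  obtain ⟨G, hG⟩ := Arm.exists_isArmModel_towerToArm hg (k + 1)
  exact ⟨hG.isDiffeo, fun p _ => Arm.armProj_prolongMap (V := Arm.Amb m k) _ _ _ _, hG.push⟩
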